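/- Notation. For integers $d\ge 1$, $n\ge 0$ identify $(\mathbb C^d)^{\otimes n}$ with the space $L^2(\mathbb Z_d^n)$ of functions on $\mathbb Z_d^n$. Put $\chi_d(x)=e^{2\pi i x/d}$, $\tau_{2d}(y)=\chi_{2d}((d^2+1)y)$, and for $P,Q\in\mathbb Z$ let $(W(P,Q)\psi)(x)=\tau_{2d}(-PQ)\,\chi_d(Px)\,\psi(x-Q)$ on $L^2(\mathbb Z_d)$. For $p,q\in\mathbb Z_d$ let $w(p,q)=W(P,Q)$, where $P,Q\in\{0,\dots,d-1\}$ represent $p,q$, and for $v=(v_1,\dots,v_n)\in(\mathbb Z_d^2)^n$ let $w(v)=\bigotimes_{i=1}^n w(v_i)$ (Weyl operators). A stabilizer group is a group $G$ (under multiplication, with identity element $\mathbb 1$) of complex multiples of Weyl operators whose only element proportional to $\mathbb 1$ is $\mathbb 1$; such a group is finite, and the corresponding stabilizer state is $\rho_G=\frac1{d^n}\sum_{g\in G}g$. For a state $\rho$ on $(\mathbb C^d)^{\otimes n}$ and $I\subseteq[n]=\{1,\dots,n\}$ let $\rho_I=\mathrm{tr}_{I^c}\,\rho$ be the reduced state and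 $S(\rho_I)=-\mathrm{tr}\,\rho_I\log_2\rho_I$; the entropy vector of $\rho$ is $(S(\rho_I))_{I\subseteq[n]}$. A real vector $f=(f_I)_{I\subseteq[n]}$ is balanced if $\sum_{I\ni i}f_I=0$ for every $i\in[n]$. It is a linear rank inequality if $\sum_{I\subseteq[n]}f_I\dim\big(\sum_{i\in I}U_i\big)\ge 0$ for all subspaces $U_1,\dots,U_n$ of any finite-dimensional vector space over any finite field. Theorem. Let $d=\prod_{i=1}^k p_i$ with $p_1,\dots,p_k$ distinct primes, and let $\rho$ be a stabilizer state on $(\mathbb C^d)^{\otimes n}$. Then: (a) There are a tensor product structure $\mathbb C^d\cong\bigotimes_{i=1}^k\mathbb C^{p_i}$, i.e. a unitary $U:\mathbb C^d\to\bigotimes_{i=1}^k\mathbb C^{p_i}$, and stabilizer states $\rho_i$ on $(\mathbb C^{p_i})^{\otimes n}$, $i=1,\dots,k$, such that $$U^{\otimes n}\,\rho\,(U^{\otimes n})^\dagger=\bigotimes_{i=1}^k\rho_i$$ under the canonical regrouping $\big(\bigotimes_{i}\mathbb C^{p_i}\big)^{\otimes n}\cong\bigotimes_{i}(\mathbb C^{p_i})^{\otimes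 n}$. (b) The entropy vector of $\rho$ satisfies every balanced linear rank inequality: if $f$ is balanced and a linear rank inequality, then $\sum_{I\subseteq[n]}f_I\,S(\rho_I)\ge 0$. -/

import Mathlib

open scoped BigOperators

noncomputable section

namespace StabilizerEntropy

/-- The index set of the computational basis of `(ℂ^d)^{⊗n} = L²(ℤ_d^n)`. -/
abbrev Config (d n : ℕ) : Type := Fin n → ZMod d

/-- Linear operators on `(ℂ^d)^{⊗n}`, as matrices in the computational basis. -/
abbrev Op (d n : ℕ) : Type := Matrix (Config d n) (Config d n) ℂ

/-- The phase space `ℤ_d^{2n}`; the `i`-th component of `v` is `(v_{p_i}, v_{q_i})`. -/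
abbrev PhaseSpace (d n : ℕ) : Type := Fin n → ZMod d × ZMod d

/-- `χ_d(x) = exp(2πi x / d)`. -/
def chi (d : ℕ) (x : ℤ) : ℂ :=
  Complex.exp (2 * Real.pi * Complex.I * x / d)

/-- `τ_{2d}(y) = χ_{2d}((d² + 1) y)`. -/
def tau (d : ℕ) (y : ℤ) : ℂ :=
  chi (2 * d) (((d : ℤ) ^ 2 + 1) * y)

/-- The one-particle Weyl operator with integer arguments,
`(W(P,Q) ψ)(x) = τ_{2d}(-PQ) χ_d(P x) ψ(x - Q)`, as a matrix. -/
def weylInt (d : ℕ) (P Q : ℤ) : Matrix (ZMod d) (ZMod d) ℂ :=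
  Matrix.of fun x y => if y = x - (Q : ZMod d) then tau d (-(P * Q)) * chi d (P * x.val) else 0

/-- The one-particle Weyl operator `w(p,q) = W(P,Q)`, where `P, Q ∈ {0, …, d-1}` represent `p, q`.
(For odd `d` every other choice of representatives gives the same operator.) -/
def weylOne (d : ℕ) (v : ZMod d × ZMod d) : Matrix (ZMod d) (ZMod d) ℂ :=
  weylInt d v.1.val v.2.val

/-- The tensor product `⊗_i A_i` of a finite family of matrices, with respect to the product
bases: its entry at `(x, y)` is `∏_i (A_i)_{x_i, y_i}`. -/
def tensor {ι : Type*} [Fintype ι] {α β : ι → Type*} (A : ∀ i, Matrix (α i) (β i) ℂ) :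
    Matrix (∀ i, α i) (∀ i, β i) ℂ :=
  Matrix.of fun x y => ∏ i, A i (x i) (y i)

/-- The Weyl operator `w(v) = ⊗_i w(v_i)` on `(ℂ^d)^{⊗n}`. -/
def weyl {d n : ℕ} (v : PhaseSpace d n) : Op d n :=
  tensor fun i => weylOne d (v i)

/-- A stabilizer group: a group of multiples of Weyl operators in which the identity is the only
multiple of the identity. -/
structure IsStabilizerGroup {d n : ℕ} [NeZero d] (G : Subgroup (Op d n)ˣ) : Prop where
  weyl_multiple : ∀ g ∈ G, ∃ (c : ℂ) (v : PhaseSpace d n), (g : Op d n) = c • weyl v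
  scalar_trivial : ∀ g ∈ G, ∀ c : ℂ, (g : Op d n) = c • (1 : Op d n) → g = 1

/-- A stabilizer group is finite, so that the sum over its elements makes sense. -/
theorem IsStabilizerGroup.finite {d n : ℕ} [NeZero d] {G : Subgroup (Op d n)ˣ}
    (hG : IsStabilizerGroup G) : Finite G := by
  choose c v h using fun g : G => hG.weyl_multiple g g.2
  have hc : ∀ g, c g ≠ 0 := fun g h0 => g.1.ne_zero (by rw [h g, h0, zero_smul])
  refine Finite.of_injective v fun a b hab => ?_
  have hb : ((b : (Op d n)ˣ) : Op d n) = (c b / c a) • ((a : (Op d n)ˣ) : Op d n) := by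
    rw [h a, h b, hab, smul_smul, div_mul_cancel₀ _ (hc a)]
  have h1 := hG.scalar_trivial _ (G.mul_mem b.2 (G.inv_mem a.2)) (c b / c a) (by
    rw [Units.val_mul, hb, smul_mul_assoc, Units.mul_inv])
  exact Subtype.ext (mul_inv_eq_one.mp h1).symm

/-- `ρ` is a stabilizer state on `(ℂ^d)^{⊗n}`: `ρ = d^{-n} ∑_{g ∈ G} g` for some stabilizer group
`G`. -/
def IsStabilizerState {d n : ℕ} [NeZero d] (ρ : Op d n) : Prop :=
  ∃ G : Subgroup (Op d n)ˣ, IsStabilizerGroup G ∧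
    ρ = ((d : ℂ) ^ n)⁻¹ • ∑ᶠ g : G, ((g : (Op d n)ˣ) : Op d n)

/-- The reduced state `ρ_I = tr_{I^c} ρ` on the subsystems in `I`. -/
def reduced {d n : ℕ} [NeZero d] (ρ : Op d n) (I : Finset (Fin n)) :
    Matrix ({j // j ∈ I} → ZMod d) ({j // j ∈ I} → ZMod d) ℂ :=
  Matrix.of fun x y => ∑ z : {j // j ∉ I} → ZMod d,
    ρ ((Equiv.piEquivPiSubtypeProd (· ∈ I) fun _ => ZMod d).symm (x, z))
      ((Equiv.piEquivPiSubtypeProd (· ∈ I) fun _ => ZMod d).symm (y, z))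

/-- The von Neumann entropy `S(ρ) = -tr(ρ log ρ)`, with the logarithm to base two and
`0 log 0 = 0`. -/
def vonNeumannEntropy {α : Type*} [Fintype α] [DecidableEq α] (ρ : Matrix α α ℂ) : ℝ :=
  -(Matrix.trace (ρ * cfc (Real.logb 2) ρ)).re

/-- The entropy vector `(S(ρ_I))_{I ⊆ [n]}`. -/
def entropyVector {d n : ℕ} [NeZero d] (ρ : Op d n) (I : Finset (Fin n)) : ℝ :=
  vonNeumannEntropy (reduced ρ I)

/-- A functional `f = (f_I)_{I ⊆ [n]}` is balanced if `∑_{I ∋ i} f_I = 0` for every `i`. -/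
def IsBalanced {n : ℕ} (f : Finset (Fin n) → ℝ) : Prop :=
  ∀ i : Fin n, ∑ I ∈ Finset.univ.filter (fun I : Finset (Fin n) => i ∈ I), f I = 0

/-- `f` defines a linear rank inequality: `∑_I f_I dim(∑_{i ∈ I} U_i) ≥ 0` for all subspaces
`U_1, …, U_n` of a finite-dimensional vector space over a finite field. -/
def IsLinearRankInequality {n : ℕ} (f : Finset (Fin n) → ℝ) : Prop :=
  ∀ (F : Type) [Field F] [Finite F] (V : Type) [AddCommGroup V] [Module F V]
    [FiniteDimensional F V] (U : Fin n → Submodule F V),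
    0 ≤ ∑ I : Finset (Fin n), f I * (Module.finrank F (⨆ i ∈ I, U i : Submodule F V) : ℝ)

end StabilizerEntropy

end

/-!
Write `d = ∏ pᵢ`. The Chinese remainder isomorphism `ℤ_d ≅ ∏ ℤ_{pᵢ}` permutes the computational
basis and so defines a unitary `ℂ^d ≅ ⊗ ℂ^{pᵢ}`. It sends shift matrices to tensor products of
shift matrices, and clock matrices to tensor products of powers of clock matrices, because every
character of `ℤ_d` factors. Hence it sends each Weyl operator to a multiple of a tensor product of
Weyl operators (`weyl_eq_smul_localHom`).

*Decomposition of the state.* Let `Gᵢ` be the part of the stabilizer group `G` that acts on the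
`i`-th tensor factor only. For `g ∈ G`, a power `g ^ a` with `a ≡ 1` modulo `pᵢ` and `a ≡ 0` modulo
the other primes lies in `Gᵢ`, and its only nontrivial tensor factor is a multiple of the
corresponding factor of `g`. As proportional elements of `G` are equal, `G` is the direct product
of the `Gᵢ` (`IsStabilizerGroup.bijective_localUnitsHom`), and so `∑_{g ∈ G} g` is a tensor product.

*Entropies.* The labels of the elements of `G` form a subgroup `M` of the phase space. The partial
trace kills the elements whose label is not supported in `I`, and it is multiplicative up to a
constant on the others. Therefore `ρ_I` is a multiple of a projection, and
`S(ρ_I) = |I| log d - log |M_I|`, where `M_I` consists of the elements of `M` supported in `I`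
(`IsStabilizerGroup.entropyVector_eq`). A balanced functional does not see the first term. The
group `M_I` is the product of its `pᵢ`-torsion subgroups, so it remains to treat subspaces `N` of
`B^n` for a vector space `B` over a prime field. There
`dim N_I = |I| dim B - dim (∑_{i ∈ I} U_i)`, where `U_i` is the image in the quotient `B^n / N` of
the `i`-th coordinate subspace. The linear rank inequality for the `U_i` is the claim
(`IsLinearRankInequality.sum_mul_finrank_nonpos`).
-/

noncomputable section

namespace StabilizerEntropy

open scoped Matrix

/-! ### Tensor products of matrices -/

section Tensor

variable {ι : Type*} [Fintype ι] {α β γ : ι → Type*}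

theorem tensor_apply (A : ∀ i, Matrix (α i) (β i) ℂ) (x : ∀ i, α i) (y : ∀ i, β i) :
    tensor A x y = ∏ i, A i (x i) (y i) := rfl

theorem tensor_mul [DecidableEq ι] [∀ i, Fintype (β i)] (A : ∀ i, Matrix (α i) (β i) ℂ)
    (B : ∀ i, Matrix (β i) (γ i) ℂ) : tensor A * tensor B = tensor fun i => A i * B i := by
  ext x y
  simp only [Matrix.mul_apply, tensor_apply, Finset.prod_univ_sum, Fintype.piFinset_univ,
    Finset.prod_mul_distrib]

theorem tensor_one [∀ i, DecidableEq (α i)] [DecidableEq (∀ i, α i)] :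
    tensor (fun i => (1 : Matrix (α i) (α i) ℂ)) = 1 := by
  ext x y
  rw [tensor_apply, Matrix.one_apply]
  split_ifs with h
  · subst h
    exact Finset.prod_eq_one fun i _ => Matrix.one_apply_eq _
  · obtain ⟨i, hi⟩ := Function.ne_iff.mp h
    exact Finset.prod_eq_zero (Finset.mem_univ i) (Matrix.one_apply_ne hi)

theorem tensor_smul (c : ι → ℂ) (A : ∀ i, Matrix (α i) (β i) ℂ) :
    tensor (fun i => c i • A i) = (∏ i, c i) • tensor A := by
  ext x y
  simp [tensor_apply, Finset.prod_mul_distrib]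

theorem tensor_conjTranspose (A : ∀ i, Matrix (α i) (β i) ℂ) :
    (tensor A)ᴴ = tensor fun i => (A i)ᴴ := by
  ext x y
  simp [tensor_apply, Matrix.conjTranspose_apply]

theorem trace_tensor [DecidableEq ι] [∀ i, Fintype (α i)] (A : ∀ i, Matrix (α i) (α i) ℂ) :
    (tensor A).trace = ∏ i, (A i).trace := by
  simp only [Matrix.trace, Matrix.diag_apply, tensor_apply, Finset.prod_univ_sum,
    Fintype.piFinset_univ]

theorem tensor_sum [DecidableEq ι] {κ : ι → Type*} [∀ i, Fintype (κ i)]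
    (A : ∀ i, κ i → Matrix (α i) (β i) ℂ) :
    tensor (fun i => ∑ a, A i a) = ∑ a : ∀ i, κ i, tensor fun i => A i (a i) := by
  ext x y
  simp only [tensor_apply, Matrix.sum_apply, Finset.prod_univ_sum, Fintype.piFinset_univ]

/-- A single tensor factor can be read off, up to a scalar, from the entries of the product: fix
the row and column indices of all other factors. -/
theorem tensor_update [DecidableEq ι] (A : ∀ i, Matrix (α i) (α i) ℂ) (z : ∀ i, α i) (i : ι)
    (x y : α i) :
    tensor A (Function.update z i x) (Function.update z i y) =
      (∏ j ∈ Finset.univ.erase i, A j (z j) (z j)) * A i x y := by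
  rw [tensor_apply, ← Finset.prod_erase_mul _ _ (Finset.mem_univ i)]
  simp only [Function.update_self]
  congr 1
  refine Finset.prod_congr rfl fun j hj => ?_
  simp [Function.update_of_ne (Finset.ne_of_mem_erase hj)]

end Tensor

theorem reduced_tensor {d n : ℕ} [NeZero d] (A : Fin n → Matrix (ZMod d) (ZMod d) ℂ)
    (I : Finset (Fin n)) :
    reduced (tensor A) I =
      (∏ j : {j // j ∉ I}, (A j).trace) • tensor fun j : {j // j ∈ I} => A j := by
  ext x y
  rw [Matrix.smul_apply, smul_eq_mul, ← trace_tensor, Matrix.trace, Finset.sum_mul]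
  refine Finset.sum_congr rfl fun z _ => ?_
  rw [tensor_apply, ← Fintype.prod_subtype_mul_prod_subtype (· ∈ I), mul_comm, Matrix.diag_apply,
    tensor_apply, tensor_apply]
  congr 1 <;> refine Finset.prod_congr (by ext; simp) fun j _ => ?_
  · simp [Equiv.piEquivPiSubtypeProd, j.2]
  · simp [Equiv.piEquivPiSubtypeProd, j.2]

/-! ### Weyl operators -/

section Weyl

variable {d : ℕ} [NeZero d]

theorem chi_eq_stdAddChar (x : ℤ) : chi d x = ZMod.stdAddChar (x : ZMod d) := by
  rw [ZMod.stdAddChar_coe, chi]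

theorem norm_tau (y : ℤ) : ‖tau d y‖ = 1 := by
  rw [tau, chi_eq_stdAddChar]
  exact AddChar.norm_apply _ _

/-- Up to its phase, a one-particle Weyl operator is a product of a clock and a shift matrix. -/
theorem weylOne_apply (v : ZMod d × ZMod d) (x y : ZMod d) :
    weylOne d v x y = tau d (-(v.1.val * v.2.val)) *
      if y = x - v.2 then ZMod.stdAddChar (v.1 * x) else 0 := by
  simp [weylOne, weylInt, chi_eq_stdAddChar]

theorem weylOne_zero : weylOne d 0 = 1 := by
  ext x y
  simp [weylOne_apply, Matrix.one_apply, tau, chi, eq_comm]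

theorem weylOne_mul (u v : ZMod d × ZMod d) :
    ∃ c : ℂ, c ≠ 0 ∧ weylOne d u * weylOne d v = c • weylOne d (u + v) := by
  have h0 : ∀ y, tau d y ≠ 0 := fun y h => by simpa [h] using norm_tau (d := d) y
  have hchar : ∀ a : ZMod d, ZMod.stdAddChar a ≠ 0 := fun a h => by
    simpa [h] using AddChar.norm_apply ZMod.stdAddChar a
  refine ⟨tau d (-(u.1.val * u.2.val)) * tau d (-(v.1.val * v.2.val)) *
    ZMod.stdAddChar (-(v.1 * u.2)) / tau d (-((u + v).1.val * (u + v).2.val)),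
    div_ne_zero (mul_ne_zero (mul_ne_zero (h0 _) (h0 _)) ?_) (h0 _), ?_⟩
  · exact hchar _
  · ext x z
    rw [Matrix.mul_apply, Finset.sum_eq_single (x - u.2)]
    · rw [Matrix.smul_apply, smul_eq_mul]
      simp only [weylOne_apply, if_true]
      rw [← mul_assoc (_ / _), div_mul_cancel₀ _ (h0 _)]
      have : (z = x - u.2 - v.2) = (z = x - (u + v).2) := by
        rw [Prod.snd_add, sub_sub]
      simp only [this]
      split_ifs
      · have : (u + v).1 * x = u.1 * x + (v.1 * (x - u.2)) + v.1 * u.2 := by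
          rw [Prod.fst_add]; ring
        rw [this, AddChar.map_add_eq_mul, AddChar.map_add_eq_mul, AddChar.map_neg_eq_inv]
        have := hchar (v.1 * u.2)
        field_simp
      · simp
    · intro y _ hy
      simp [weylOne_apply, hy]
    · simp

theorem weylOne_conjTranspose_mul (v : ZMod d × ZMod d) :
    (weylOne d v)ᴴ * weylOne d v = 1 := by
  ext x z
  rw [Matrix.mul_apply, Finset.sum_eq_single (x + v.2)]
  · simp only [Matrix.conjTranspose_apply, weylOne_apply, add_sub_cancel_right, if_true]
    by_cases h : x = z
    · subst h
      rw [if_pos rfl, Matrix.one_apply_eq, RCLike.star_def, RCLike.conj_mul, norm_mul,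
        norm_tau, AddChar.norm_apply]
      simp
    · rw [if_neg (Ne.symm h), Matrix.one_apply_ne h]
      simp
  · intro y _ hy
    have : x ≠ y - v.2 := fun h => hy (by rw [h]; ring)
    simp [Matrix.conjTranspose_apply, weylOne_apply, this]
  · simp

theorem trace_weylOne {v : ZMod d × ZMod d} (hv : v ≠ 0) : (weylOne d v).trace = 0 := by
  simp only [Matrix.trace, Matrix.diag_apply, weylOne_apply, ← Finset.mul_sum]
  refine mul_eq_zero_of_right _ ?_
  by_cases h2 : v.2 = 0
  · have h1 : v.1 ≠ 0 := fun h => hv (Prod.ext h h2)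
    have := AddChar.sum_mulShift v.1 (ZMod.isPrimitive_stdAddChar d)
    simpa [h2, h1, mul_comm] using this
  · exact Finset.sum_eq_zero fun x _ => if_neg fun h => h2 (sub_eq_self.mp h.symm)

variable {n : ℕ}

theorem weyl_zero : weyl (0 : PhaseSpace d n) = 1 := by
  simp only [weyl, Pi.zero_apply, weylOne_zero, tensor_one]

theorem weyl_mul (u v : PhaseSpace d n) :
    ∃ c : ℂ, c ≠ 0 ∧ weyl u * weyl v = c • weyl (u + v) := by
  choose c hc h using fun i => weylOne_mul (u i) (v i)
  refine ⟨∏ i, c i, Finset.prod_ne_zero_iff.mpr fun i _ => hc i, ?_⟩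
  simp only [weyl, tensor_mul, h, tensor_smul, Pi.add_apply]

theorem weyl_pow (u : PhaseSpace d n) (m : ℕ) :
    ∃ c : ℂ, c ≠ 0 ∧ weyl u ^ m = c • weyl (m • u) := by
  induction m with
  | zero => exact ⟨1, one_ne_zero, by simp [weyl_zero]⟩
  | succ m ih =>
    obtain ⟨a, ha, h⟩ := ih
    obtain ⟨b, hb, h'⟩ := weyl_mul (m • u) u
    exact ⟨a * b, mul_ne_zero ha hb, by
      rw [pow_succ, h, smul_mul_assoc, h', smul_smul, succ_nsmul]⟩

theorem weyl_conjTranspose_mul (v : PhaseSpace d n) : (weyl v)ᴴ * weyl v = 1 := by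
  simp only [weyl, tensor_conjTranspose, tensor_mul, weylOne_conjTranspose_mul, tensor_one]

theorem isUnit_weyl (v : PhaseSpace d n) : IsUnit (weyl v) :=
  IsUnit.of_mul_eq_one _ (mul_eq_one_comm.mp (weyl_conjTranspose_mul v))

theorem trace_weyl {v : PhaseSpace d n} (hv : v ≠ 0) : (weyl v).trace = 0 := by
  obtain ⟨i, hi⟩ := Function.ne_iff.mp hv
  rw [weyl, trace_tensor]
  exact Finset.prod_eq_zero (Finset.mem_univ i) (trace_weylOne hi)

/-- Weyl operators with distinct labels are not proportional. -/
theorem eq_of_smul_weyl_eq {a b : ℂ} (ha : a ≠ 0) {u v : PhaseSpace d n}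
    (h : a • weyl u = b • weyl v) : u = v := by
  obtain ⟨r, hr, h1⟩ := weyl_mul u (-u)
  obtain ⟨s, hs, h2⟩ := weyl_mul v (-u)
  by_contra hne
  have h3 : (a * r) • (1 : Op d n) = (b * s) • weyl (v + -u) := by
    rw [← weyl_zero, ← add_neg_cancel u, ← smul_smul, ← smul_smul, ← h1, ← h2, ← smul_mul_assoc,
      ← smul_mul_assoc, h]
  have h4 := congrArg Matrix.trace h3
  rw [Matrix.trace_smul, Matrix.trace_smul, trace_weyl fun h0 => hne (add_neg_eq_zero.mp h0).symm,
    Matrix.trace_one, smul_zero, smul_eq_mul] at h4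
  have hcard : (Fintype.card (Config d n) : ℂ) ≠ 0 := Nat.cast_ne_zero.mpr Fintype.card_ne_zero
  exact mul_ne_zero (mul_ne_zero ha hr) hcard h4

/-- Taking the partial trace keeps a Weyl operator whose label is supported in `I`, up to a
dimension factor. -/
theorem reduced_weyl_of_support {v : PhaseSpace d n} {I : Finset (Fin n)}
    (hv : ∀ j ∉ I, v j = 0) :
    reduced (weyl v) I =
      ((d : ℂ) ^ (n - I.card)) • tensor fun j : {j // j ∈ I} => weylOne d (v j) := by
  rw [weyl, reduced_tensor]
  congr 1
  rw [Finset.prod_congr rfl fun (j : {j // j ∉ I}) _ => by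
    rw [hv j j.2, weylOne_zero, Matrix.trace_one, ZMod.card]]
  simp [Fintype.card_subtype_compl]

/-- The partial trace kills a Weyl operator whose label is not supported in `I`. -/
theorem reduced_weyl_of_not_support {v : PhaseSpace d n} {I : Finset (Fin n)}
    (hv : ¬ ∀ j ∉ I, v j = 0) : reduced (weyl v) I = 0 := by
  push Not at hv
  obtain ⟨j, hj, hvj⟩ := hv
  rw [weyl, reduced_tensor, Finset.prod_eq_zero (Finset.mem_univ ⟨j, hj⟩) (trace_weylOne hvj),
    zero_smul]

end Weyl

/-! ### The Chinese remainder theorem for Weyl operators -/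

section CRT

variable {ι : Type*} {p : ι → ℕ} {d n : ℕ}

/-- Under the Chinese remainder isomorphism, the standard character of `ℤ_d` is a product of
characters of the factors. They need not be the standard ones: `m i` is an inverse of `d / p i`
modulo `p i`. -/
theorem exists_stdAddChar_eq_prod [Fintype ι] [∀ i, NeZero (p i)] [NeZero d]
    (hp : Pairwise (Function.onFun Nat.Coprime p)) (hd : d = ∏ i, p i)
    (e : ZMod d ≃+* ∀ i, ZMod (p i)) :
    ∃ m : ∀ i, ZMod (p i), ∀ x : ZMod d,
      ZMod.stdAddChar x = ∏ i, ZMod.stdAddChar (m i * e x i) := by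
  classical
  rcases isEmpty_or_nonempty ι with hι | hι
  · obtain rfl : d = 1 := by simpa using hd
    exact ⟨fun i => 0, fun x => by rw [Subsingleton.elim x 0]; simp⟩
  have hp' : Pairwise (Function.onFun IsCoprime fun i => (p i : ℤ)) := fun i j hij =>
    Nat.isCoprime_iff_coprime.mpr (hp hij)
  obtain ⟨μ, hμ⟩ := exists_sum_eq_one_iff_pairwise_coprime'.mpr hp'
  have hp0 : ∀ i, (p i : ℂ) ≠ 0 := fun i => Nat.cast_ne_zero.mpr (NeZero.ne _)
  -- Bézout's identity `∑ᵢ μᵢ (d / pᵢ) = 1`, divided by `d`.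
  have hμ' : ∑ i, (μ i : ℂ) / p i = 1 / d := by
    have h1 : ∑ i, (μ i : ℂ) * ∏ j ∈ {i}ᶜ, (p j : ℂ) = 1 := by exact_mod_cast hμ
    rw [← h1, hd, Finset.sum_div]
    refine Finset.sum_congr rfl fun i _ => ?_
    have h2 : ((∏ i, p i : ℕ) : ℂ) = p i * ∏ j ∈ {i}ᶜ, (p j : ℂ) := by
      rw [Nat.cast_prod, Fintype.prod_eq_mul_prod_compl i]
    have h3 : ∏ j ∈ {i}ᶜ, (p j : ℂ) ≠ 0 := Finset.prod_ne_zero_iff.mpr fun j _ => hp0 j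
    rw [h2, mul_div_mul_right _ _ h3]
  refine ⟨fun i => (μ i : ZMod (p i)), fun x => ?_⟩
  obtain ⟨N, rfl⟩ := ZMod.intCast_surjective x
  simp only [map_intCast, Pi.intCast_apply, ← Int.cast_mul, ZMod.stdAddChar_coe]
  rw [← Complex.exp_sum]
  congr 1
  calc 2 * (Real.pi : ℂ) * Complex.I * N / d = 2 * Real.pi * Complex.I * N * (1 / d) := by ring
    _ = _ := by
      rw [← hμ', Finset.mul_sum]
      refine Finset.sum_congr rfl fun i _ => ?_
      push_cast
      ring

/-- The canonical regrouping `L²(ℤ_d^n) ≅ ⊗ᵢ L²(ℤ_{pᵢ}^n)` on the level of basis labels, for a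
ring isomorphism `ℤ_d ≅ ∏ᵢ ℤ_{pᵢ}`. -/
def regroup (e : ZMod d ≃+* ∀ i, ZMod (p i)) (n : ℕ) : Config d n ≃ ∀ i, Config (p i) n :=
  (Equiv.piCongrRight fun _ => e.toEquiv).trans (Equiv.piComm _)

theorem regroup_apply (e : ZMod d ≃+* ∀ i, ZMod (p i)) (x : Config d n) (i : ι) (j : Fin n) :
    regroup e n x i j = e (x j) i := rfl

/-- The phase space label in the `i`-th factor of a Weyl operator on `(ℂ^d)^{⊗n}`. The momenta are
rescaled by `m`, which relates the standard characters, as in `exists_stdAddChar_eq_prod`. -/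
def localLabel (e : ZMod d ≃+* ∀ i, ZMod (p i)) (m : ∀ i, ZMod (p i)) (v : PhaseSpace d n)
    (i : ι) : PhaseSpace (p i) n :=
  fun j => (m i * e (v j).1 i, e (v j).2 i)

theorem localLabel_nsmul (e : ZMod d ≃+* ∀ i, ZMod (p i)) (m : ∀ i, ZMod (p i))
    (v : PhaseSpace d n) (i : ι) (a : ℕ) :
    localLabel e m (a • v) i = a • localLabel e m v i := by
  ext j <;> simp [localLabel, mul_left_comm]

theorem smul_mulSingle [DecidableEq ι] (i : ι) (c : ℂ) (A : Op (p i) n) :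
    (Pi.mulSingle i (c • A) : ∀ j, Op (p j) n) =
      fun j => (Pi.mulSingle i c : ι → ℂ) j • (Pi.mulSingle i A : ∀ j, Op (p j) n) j := by
  ext1 j
  rcases eq_or_ne j i with rfl | hj
  · simp
  · simp [hj]

theorem coe_mulSingle [DecidableEq ι] [∀ i, NeZero (p i)] (i : ι) (h : (Op (p i) n)ˣ) :
    (fun j => ((Pi.mulSingle i h : ∀ j, (Op (p j) n)ˣ) j : Op (p j) n)) =
      Pi.mulSingle i (h : Op (p i) n) := by
  ext1 j
  rcases eq_or_ne j i with rfl | hj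
  · simp
  · simp [hj]

variable [Fintype ι] [NeZero d] [∀ i, NeZero (p i)]

/-- The operator on `(ℂ^d)^{⊗n}` that corresponds to `⊗ᵢ Aᵢ` under the regrouping. -/
def localHom [DecidableEq ι] (e : ZMod d ≃+* ∀ i, ZMod (p i)) (n : ℕ) :
    (∀ i, Op (p i) n) →* Op d n where
  toFun A := (tensor A).submatrix (regroup e n) (regroup e n)
  map_one' := by
    change (tensor fun i => (1 : Op (p i) n)).submatrix _ _ = 1
    rw [tensor_one, Matrix.submatrix_one_equiv]
  map_mul' A B := by
    rw [Matrix.submatrix_mul_equiv, tensor_mul]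
    rfl

variable [DecidableEq ι]

theorem localHom_def (e : ZMod d ≃+* ∀ i, ZMod (p i)) (A : ∀ i, Op (p i) n) :
    localHom e n A = (tensor A).submatrix (regroup e n) (regroup e n) := rfl

theorem localHom_smul (e : ZMod d ≃+* ∀ i, ZMod (p i)) (c : ι → ℂ) (A : ∀ i, Op (p i) n) :
    localHom e n (fun i => c i • A i) = (∏ i, c i) • localHom e n A := by
  rw [localHom_def, tensor_smul, localHom_def, Matrix.submatrix_smul]
  rfl

theorem tensor_eq_of_localHom_eq (e : ZMod d ≃+* ∀ i, ZMod (p i)) {A B : ∀ i, Op (p i) n} {c : ℂ}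
    (h : localHom e n A = c • localHom e n B) : tensor A = c • tensor B := by
  have h' : (tensor A).submatrix (regroup e n) (regroup e n) =
      (c • tensor B).submatrix (regroup e n) (regroup e n) := h
  simpa using congrArg (fun M => M.submatrix (regroup e n).symm (regroup e n).symm) h'

/-- Up to a phase, a Weyl operator on `(ℂ^d)^{⊗n}` is a tensor product of Weyl operators of the
factors. -/
theorem weyl_eq_smul_localHom (e : ZMod d ≃+* ∀ i, ZMod (p i)) {m : ∀ i, ZMod (p i)}
    (hm : ∀ x : ZMod d, ZMod.stdAddChar x = ∏ i, ZMod.stdAddChar (m i * e x i))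
    (v : PhaseSpace d n) :
    ∃ c : ℂ, c ≠ 0 ∧ weyl v = c • localHom e n fun i => weyl (localLabel e m v i) := by
  have h0 : ∀ (d : ℕ) [NeZero d] (y : ℤ), tau d y ≠ 0 := fun d _ y h => by
    simpa [h] using norm_tau (d := d) y
  have key : ∀ u : ZMod d × ZMod d, ∃ c : ℂ, c ≠ 0 ∧ ∀ x y, weylOne d u x y =
      c * ∏ i, weylOne (p i) (m i * e u.1 i, e u.2 i) (e x i) (e y i) := by
    intro u
    have hc : ∏ i, tau (p i) (-((m i * e u.1 i).val * (e u.2 i).val)) ≠ 0 :=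
      Finset.prod_ne_zero_iff.mpr fun i _ => h0 _ _
    refine ⟨tau d (-(u.1.val * u.2.val)) /
      ∏ i, tau (p i) (-((m i * e u.1 i).val * (e u.2 i).val)), div_ne_zero (h0 _ _) hc, ?_⟩
    intro x y
    simp only [weylOne_apply, Finset.prod_mul_distrib]
    rw [← mul_assoc, div_mul_cancel₀ _ hc]
    congr 1
    by_cases hxy : y = x - u.2
    · subst hxy
      rw [if_pos rfl, hm]
      refine Finset.prod_congr rfl fun i _ => ?_
      rw [if_pos (by rw [map_sub, Pi.sub_apply]), map_mul e, Pi.mul_apply, mul_assoc]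
    · rw [if_neg hxy]
      have : e y ≠ e x - e u.2 := fun h => hxy (e.injective (by rw [h, map_sub]))
      obtain ⟨i, hi⟩ := Function.ne_iff.mp this
      exact (Finset.prod_eq_zero (Finset.mem_univ i) (if_neg hi)).symm
  choose c hc h using fun j => key (v j)
  refine ⟨∏ j, c j, Finset.prod_ne_zero_iff.mpr fun j _ => hc j, ?_⟩
  ext x y
  rw [weyl, tensor_apply, Finset.prod_congr rfl fun j _ => h j (x j) (y j),
    Finset.prod_mul_distrib, Finset.prod_comm]
  rfl

end CRT

/-! ### Decomposition of stabilizer groups -/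

section Decomposition

variable {ι : Type*} [Fintype ι] [DecidableEq ι] {p : ι → ℕ} [∀ i, NeZero (p i)] {d n : ℕ}
  [NeZero d]

/-- `localHom` on invertible operators. -/
def localUnitsHom (e : ZMod d ≃+* ∀ i, ZMod (p i)) (n : ℕ) :
    (∀ i, (Op (p i) n)ˣ) →* (Op d n)ˣ :=
  (Units.map (localHom e n)).comp MulEquiv.piUnits.symm.toMonoidHom

theorem coe_localUnitsHom (e : ZMod d ≃+* ∀ i, ZMod (p i)) (h : ∀ i, (Op (p i) n)ˣ) :
    (localUnitsHom e n h : Op d n) = localHom e n fun i => (h i : Op (p i) n) := rfl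

/-- The part of a group of operators on `(ℂ^d)^{⊗n}` that acts on the `i`-th factor only. -/
def localGroup (e : ZMod d ≃+* ∀ i, ZMod (p i)) (G : Subgroup (Op d n)ˣ) (i : ι) :
    Subgroup (Op (p i) n)ˣ :=
  G.comap ((localUnitsHom e n).comp (MonoidHom.mulSingle (fun i => (Op (p i) n)ˣ) i))

theorem mem_localGroup (e : ZMod d ≃+* ∀ i, ZMod (p i)) {G : Subgroup (Op d n)ˣ} {i : ι}
    {h : (Op (p i) n)ˣ} :
    h ∈ localGroup e G i ↔ localUnitsHom e n (Pi.mulSingle i h) ∈ G := Iff.rfl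

theorem localHom_mulSingle_smul (e : ZMod d ≃+* ∀ i, ZMod (p i)) (i : ι) (c : ℂ)
    (A : Op (p i) n) :
    localHom e n (Pi.mulSingle i (c • A)) = c • localHom e n (Pi.mulSingle i A) := by
  rw [smul_mulSingle, localHom_smul, Fintype.prod_pi_mulSingle']

/-- If `A ⊗ 1` is a multiple of a product operator, then `A` is a multiple of the corresponding
factor. -/
theorem exists_eq_smul_of_localHom_mulSingle (e : ZMod d ≃+* ∀ i, ZMod (p i)) {i : ι}
    {A : Op (p i) n} {c : ℂ} {B : ∀ j, Op (p j) n}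
    (h : localHom e n (Pi.mulSingle i A) = c • localHom e n B) : ∃ b : ℂ, A = b • B i := by
  have h' := tensor_eq_of_localHom_eq e h
  refine ⟨c * ∏ j ∈ Finset.univ.erase i, B j 0 0, ?_⟩
  ext x y
  have h1 := congrFun (congrFun h' (Function.update 0 i x)) (Function.update 0 i y)
  rw [Matrix.smul_apply, tensor_update, tensor_update, Pi.mulSingle_eq_same,
    Finset.prod_eq_one fun j hj => by
      rw [Pi.mulSingle_eq_of_ne (Finset.ne_of_mem_erase hj)]; exact Matrix.one_apply_eq _,
    one_mul] at h1
  rw [h1, Matrix.smul_apply, smul_eq_mul, smul_eq_mul, mul_assoc]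
  rfl

/-- If a product operator is the identity, then its factors are scalars. -/
theorem exists_eq_smul_one_of_localHom_eq_one (e : ZMod d ≃+* ∀ i, ZMod (p i))
    {A : ∀ j, Op (p j) n} (h : localHom e n A = 1) (i : ι) : ∃ b : ℂ, A i = b • 1 := by
  have h' : tensor A = tensor fun j => (1 : Op (p j) n) := by
    simpa using tensor_eq_of_localHom_eq e (c := 1) (B := fun j => 1) (by
      rw [h, one_smul]; exact (map_one _).symm)
  have h1 := fun x y =>
    congrFun (congrFun h' (Function.update 0 i x)) (Function.update 0 i y)
  simp only [tensor_update, Matrix.one_apply_eq, Finset.prod_const_one, one_mul] at h1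
  set a := ∏ j ∈ Finset.univ.erase i,
    A j ((0 : ∀ j, Config (p j) n) j) ((0 : ∀ j, Config (p j) n) j)
  have ha : a ≠ 0 := fun h0 => by
    have := h1 0 0
    rw [h0, zero_mul, Matrix.one_apply_eq] at this
    exact zero_ne_one this
  refine ⟨a⁻¹, ?_⟩
  ext x y
  rw [Matrix.smul_apply, ← h1 x y, smul_eq_mul, inv_mul_cancel_left₀ ha]

theorem IsStabilizerGroup.isStabilizerGroup_localGroup {G : Subgroup (Op d n)ˣ}
    (hG : IsStabilizerGroup G) (e : ZMod d ≃+* ∀ i, ZMod (p i)) {m : ∀ i, ZMod (p i)}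
    (hm : ∀ x : ZMod d, ZMod.stdAddChar x = ∏ i, ZMod.stdAddChar (m i * e x i)) (i : ι) :
    IsStabilizerGroup (localGroup e G i) where
  weyl_multiple h hh := by
    obtain ⟨c, v, hc⟩ := hG.weyl_multiple _ ((mem_localGroup e).mp hh)
    obtain ⟨a, -, ha⟩ := weyl_eq_smul_localHom e hm v
    rw [coe_localUnitsHom, coe_mulSingle, ha, smul_smul] at hc
    obtain ⟨b, hb⟩ := exists_eq_smul_of_localHom_mulSingle e hc
    exact ⟨b, _, hb⟩
  scalar_trivial h hh c hc := by
    have h2 : (localUnitsHom e n (Pi.mulSingle i h) : Op d n) = c • 1 := by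
      rw [coe_localUnitsHom, coe_mulSingle, hc, localHom_mulSingle_smul, Pi.mulSingle_one,
        map_one]
    have h1 := hG.scalar_trivial _ ((mem_localGroup e).mp hh) c h2
    rw [h1, Units.val_one] at h2
    have hc1 : c = 1 := by simpa using (congrFun (congrFun h2 0) 0).symm
    ext1
    rw [hc, hc1, one_smul, Units.val_one]

/-- A tensor product of elements of the groups `localGroup e G i` lies in `G`. -/
theorem localUnitsHom_mem {G : Subgroup (Op d n)ˣ} (e : ZMod d ≃+* ∀ i, ZMod (p i))
    {h : ∀ i, (Op (p i) n)ˣ} (hh : ∀ i, h i ∈ localGroup e G i) : localUnitsHom e n h ∈ G :=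
  Subgroup.pi_mem_of_mulSingle_mem (H := G.comap (localUnitsHom e n)) h hh

/-- The factors of an element `g` of a stabilizer group on `(ℂ^d)^{⊗n}` are, up to scalars, powers
of `g`: raise it to a power which is `1` modulo `p i` and `0` modulo the other factors. Therefore
`g` is a tensor product of elements of the groups `localGroup e G i`. -/
theorem IsStabilizerGroup.exists_localUnitsHom_eq {G : Subgroup (Op d n)ˣ}
    (hG : IsStabilizerGroup G) (e : ZMod d ≃+* ∀ i, ZMod (p i)) {m : ∀ i, ZMod (p i)}
    (hm : ∀ x : ZMod d, ZMod.stdAddChar x = ∏ i, ZMod.stdAddChar (m i * e x i))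
    {g : (Op d n)ˣ} (hg : g ∈ G) :
    ∃ h : ∀ i, (Op (p i) n)ˣ, (∀ i, h i ∈ localGroup e G i) ∧ localUnitsHom e n h = g := by
  obtain ⟨c, v, hc⟩ := hG.weyl_multiple g hg
  have hc0 : c ≠ 0 := fun h0 => g.ne_zero (by rw [hc, h0, zero_smul])
  have key : ∀ i, ∃ b : ℂ, b ≠ 0 ∧ ∃ h : (Op (p i) n)ˣ,
      h ∈ localGroup e G i ∧
      (h : Op (p i) n) = b • weyl (localLabel e m v i) := by
    intro i
    set a : ℕ := (e.symm (Pi.single i 1)).val with ha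
    have hae : ∀ j, (a : ZMod (p j)) = (Pi.single i 1 : ∀ j, ZMod (p j)) j := by
      intro j
      rw [← e.apply_symm_apply (Pi.single i 1), ← ZMod.natCast_zmod_val (e.symm (Pi.single i 1)),
        ← ha, map_natCast, Pi.natCast_apply]
    have hlabel : (fun j => weyl (localLabel e m (a • v) j)) =
        Pi.mulSingle i (weyl (localLabel e m v i)) := by
      ext1 j
      have hsm : ∀ u : PhaseSpace (p j) n, a • u = (a : ZMod (p j)) • u := fun u => by
        rw [Nat.cast_smul_eq_nsmul]
      rw [localLabel_nsmul, hsm, hae]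
      rcases eq_or_ne j i with rfl | hj
      · simp
      · rw [Pi.single_eq_of_ne hj, zero_smul, weyl_zero, Pi.mulSingle_eq_of_ne hj]
    obtain ⟨r, hr, hr'⟩ := weyl_pow v a
    obtain ⟨s, hs, hs'⟩ := weyl_eq_smul_localHom e hm (a • v)
    have hb : c ^ a * r * s ≠ 0 := mul_ne_zero (mul_ne_zero (pow_ne_zero _ hc0) hr) hs
    obtain ⟨w, hw⟩ := ((isUnit_weyl (localLabel e m v i)).smul (Units.mk0 _ hb))
    refine ⟨c ^ a * r * s, hb, w, ?_, by rw [hw]; rfl⟩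
    rw [mem_localGroup]
    have : localUnitsHom e n (Pi.mulSingle i w) = g ^ a := by
      ext1
      rw [coe_localUnitsHom, coe_mulSingle, hw, Units.smul_def, Units.val_mk0,
        localHom_mulSingle_smul, ← hlabel, Units.val_pow_eq_pow_val, hc, smul_pow, hr', hs',
        smul_smul, smul_smul]
    rw [this]
    exact G.pow_mem hg a
  choose b hb h hh hw using key
  refine ⟨h, hh, ?_⟩
  obtain ⟨s, hs, hs'⟩ := weyl_eq_smul_localHom e hm v
  have h1 : (localUnitsHom e n h : Op d n) = ((∏ i, b i) / (c * s)) • (g : Op d n) := by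
    rw [coe_localUnitsHom, funext hw, localHom_smul, hc, hs', smul_smul, smul_smul,
      mul_assoc, div_mul_cancel₀ _ (mul_ne_zero hc0 hs)]
  -- Both sides lie in `G` and they are proportional, so they are equal.
  refine mul_inv_eq_one.mp (hG.scalar_trivial _
    (G.mul_mem (localUnitsHom_mem e hh) (G.inv_mem hg)) ((∏ i, b i) / (c * s)) ?_)
  rw [Units.val_mul, h1, smul_mul_assoc, Units.mul_inv]

/-- A stabilizer group on `(ℂ^d)^{⊗n}` is the internal direct product of the groups
`localGroup e G i`. -/
theorem IsStabilizerGroup.bijective_localUnitsHom {G : Subgroup (Op d n)ˣ}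
    (hG : IsStabilizerGroup G) (e : ZMod d ≃+* ∀ i, ZMod (p i)) {m : ∀ i, ZMod (p i)}
    (hm : ∀ x : ZMod d, ZMod.stdAddChar x = ∏ i, ZMod.stdAddChar (m i * e x i)) :
    Function.Bijective fun h : ∀ i, localGroup e G i =>
      (⟨localUnitsHom e n fun i => h i, localUnitsHom_mem e fun i => (h i).2⟩ : G) := by
  constructor
  · intro h h' hhh
    have h1 : localUnitsHom e n
        ((fun i => (h i : (Op (p i) n)ˣ)) * fun i => (h' i : (Op (p i) n)ˣ)⁻¹) = 1 := by
      have := congrArg Subtype.val hhh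
      have h2 : (fun i => (h' i : (Op (p i) n)ˣ)⁻¹) = (fun i => (h' i : (Op (p i) n)ˣ))⁻¹ := rfl
      rw [h2, map_mul, map_inv]
      exact mul_inv_eq_one.mpr this
    ext1 i
    obtain ⟨b, hb⟩ := exists_eq_smul_one_of_localHom_eq_one e (congrArg Units.val h1) i
    exact Subtype.ext (mul_inv_eq_one.mp ((hG.isStabilizerGroup_localGroup e hm i).scalar_trivial _
      (mul_mem (h i).2 (inv_mem (h' i).2)) b hb))
  · rintro ⟨g, hg⟩
    obtain ⟨h, hh, rfl⟩ := hG.exists_localUnitsHom_eq e hm hg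
    exact ⟨fun i => ⟨h i, hh i⟩, rfl⟩

theorem IsStabilizerState.exists_eq_localHom (hp : Pairwise (Function.onFun Nat.Coprime p))
    (hd : d = ∏ i, p i) (e : ZMod d ≃+* ∀ i, ZMod (p i)) {ρ : Op d n}
    (hρ : IsStabilizerState ρ) :
    ∃ σ : ∀ i, Op (p i) n, (∀ i, IsStabilizerState (σ i)) ∧ ρ = localHom e n σ := by
  classical
  obtain ⟨m, hm⟩ := exists_stdAddChar_eq_prod hp hd e
  obtain ⟨G, hG, rfl⟩ := hρ
  have hfin := fun i => (hG.isStabilizerGroup_localGroup e hm i).finite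
  have := fun i => Fintype.ofFinite (localGroup e G i)
  have := hG.finite
  have := Fintype.ofFinite G
  refine ⟨_, fun i => ⟨localGroup e G i, hG.isStabilizerGroup_localGroup e hm i, rfl⟩, ?_⟩
  simp only [finsum_eq_sum_of_fintype]
  rw [localHom_smul e (fun i => ((p i : ℂ) ^ n)⁻¹), Finset.prod_inv_distrib, Finset.prod_pow,
    ← Nat.cast_prod, ← hd]
  congr 1
  rw [localHom_def, tensor_sum,
    ← (Equiv.ofBijective _ (hG.bijective_localUnitsHom e hm)).sum_comp]
  ext x y
  rw [Matrix.submatrix_apply, Matrix.sum_apply, Matrix.sum_apply]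
  rfl

end Decomposition

/-! ### The local unitary -/

/-- The permutation matrix of an isomorphism `ℤ_d ≅ ∏ᵢ ℤ_{pᵢ}`, as a matrix from `ℂ^d` to
`⊗ᵢ ℂ^{pᵢ}`, is unitary, and its `n`-th tensor power implements the regrouping. -/
theorem exists_unitary_conj_localHom {ι : Type*} [Fintype ι] [DecidableEq ι] {p : ι → ℕ}
    [∀ i, NeZero (p i)] {d n : ℕ} [NeZero d] (e : ZMod d ≃+* ∀ i, ZMod (p i)) :
    ∃ U : Matrix (∀ i, ZMod (p i)) (ZMod d) ℂ, U * U.conjTranspose = 1 ∧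
      U.conjTranspose * U = 1 ∧ ∀ σ : ∀ i, Op (p i) n,
        tensor (fun _ : Fin n => U) * localHom e n σ *
          (tensor fun _ : Fin n => U).conjTranspose =
        (tensor σ).submatrix (fun x i j => x j i) (fun x i j => x j i) := by
  set U : Matrix (∀ i, ZMod (p i)) (ZMod d) ℂ := (1 : Matrix _ _ ℂ).submatrix e.symm id with hU
  have hUs : U.conjTranspose = (1 : Matrix _ _ ℂ).submatrix id e.symm := by
    rw [hU, Matrix.conjTranspose_submatrix, Matrix.conjTranspose_one]
  let E : (Fin n → ∀ i, ZMod (p i)) ≃ Config d n := Equiv.piCongrRight fun _ => e.symm.toEquiv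
  have hT : tensor (fun _ : Fin n => U) = (1 : Op d n).submatrix E id := by
    rw [← tensor_one]
    rfl
  have hTs : (tensor fun _ : Fin n => U).conjTranspose = (1 : Op d n).submatrix id E := by
    rw [hT, Matrix.conjTranspose_submatrix, Matrix.conjTranspose_one]
  refine ⟨U, ?_, ?_, fun σ => ?_⟩
  · rw [hUs, hU]
    ext x y
    simp [Matrix.mul_apply, Matrix.one_apply]
  · rw [hUs, hU]
    have := Matrix.submatrix_mul_equiv (1 : Matrix (ZMod d) (ZMod d) ℂ)
      (1 : Matrix (ZMod d) (ZMod d) ℂ) id e.symm.toEquiv id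
    simpa using this
  · have hl : ∀ A : Op d n, (1 : Op d n).submatrix E id * A = A.submatrix E id := fun A => by
      ext x y
      simp [Matrix.mul_apply, Matrix.one_apply]
    have hr : ∀ A : Matrix (Fin n → ∀ i, ZMod (p i)) (Config d n) ℂ,
        A * (1 : Op d n).submatrix id E = A.submatrix id E := fun A => by
      ext x y
      simp [Matrix.mul_apply, Matrix.one_apply]
    rw [hTs, hT, hl, hr, localHom_def]
    ext x y
    simp only [Matrix.submatrix_apply, id]
    congr 1 <;> ext i j <;> simp [regroup_apply, E]

/-! ### Entropy of flat states and partial traces -/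

/-- A state whose nonzero eigenvalues are all equal to `r` has entropy `-log₂ r`. -/
theorem vonNeumannEntropy_of_mul_self {α : Type*} [Fintype α] [DecidableEq α] {R : Matrix α α ℂ}
    (hR : R.IsHermitian) {r : ℝ} (hmul : R * R = r • R) (htr : R.trace = 1) :
    vonNeumannEntropy R = -Real.logb 2 r := by
  -- The eigenvalues are roots of `X² - r X`, which annihilates `R`.
  have hspec : ∀ x ∈ spectrum ℝ R, x * x = r * x := by
    intro x hx
    have h1 := spectrum.subset_polynomial_aeval R
      (Polynomial.X * Polynomial.X - Polynomial.C r * Polynomial.X) ⟨x, hx, rfl⟩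
    have h2 : Polynomial.aeval R
        (Polynomial.X * Polynomial.X - Polynomial.C r * Polynomial.X) = 0 := by
      simp [hmul, Algebra.smul_def]
    rw [h2, spectrum.mem_iff] at h1
    by_contra hne
    refine h1 ?_
    have h3 : IsUnit (x * x - r * x) := (sub_ne_zero.mpr hne).isUnit
    simpa using h3.map (algebraMap ℝ (Matrix α α ℂ))
  have hsa : IsSelfAdjoint R := hR
  have hcont : ∀ f : ℝ → ℝ, ContinuousOn f (spectrum ℝ R) := fun f =>
    (Matrix.finite_real_spectrum (A := R)).continuousOn f
  have h : R * cfc (Real.logb 2) R = Real.logb 2 r • R := by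
    nth_rewrite 1 [← cfc_id' ℝ R]
    rw [← cfc_mul _ _ R (hcont _) (hcont _), ← cfc_const_mul_id _ R]
    refine cfc_congr fun x hx => ?_
    rcases eq_or_ne x 0 with rfl | hx0
    · simp
    · have : x = r := mul_right_cancel₀ hx0 (hspec x hx)
      simp only [this, mul_comm]
  rw [vonNeumannEntropy, h, Matrix.trace_smul, htr]
  simp

section PartialTrace

variable {d n : ℕ} [NeZero d]

/-- The partial trace as a linear map. -/
def reducedLinear (I : Finset (Fin n)) :
    Op d n →ₗ[ℂ] Matrix ({j // j ∈ I} → ZMod d) ({j // j ∈ I} → ZMod d) ℂ where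
  toFun ρ := reduced ρ I
  map_add' A B := by
    ext x y
    simp [reduced, Finset.sum_add_distrib]
  map_smul' c A := by
    ext x y
    simp [reduced, Finset.mul_sum]

theorem reducedLinear_apply (I : Finset (Fin n)) (ρ : Op d n) :
    reducedLinear I ρ = reduced ρ I := rfl

theorem trace_reduced (ρ : Op d n) (I : Finset (Fin n)) : (reduced ρ I).trace = ρ.trace := by
  rw [Matrix.trace, Matrix.trace,
    ← (Equiv.piEquivPiSubtypeProd (· ∈ I) fun _ => ZMod d).symm.sum_comp, Fintype.sum_prod_type]
  rfl

theorem isHermitian_reduced {ρ : Op d n} (hρ : ρ.IsHermitian) (I : Finset (Fin n)) :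
    (reduced ρ I).IsHermitian := by
  ext x y
  rw [Matrix.conjTranspose_apply]
  simp only [reduced, Matrix.of_apply, star_sum]
  exact Finset.sum_congr rfl fun z _ => hρ.apply _ _

end PartialTrace

/-! ### Phase space labels and the entropy of stabilizer states -/

/-- The subgroup of vectors with components in `A` that vanish outside `I`. -/
def supported {n : ℕ} (A : Type*) [AddCommGroup A] (I : Finset (Fin n)) :
    AddSubgroup (Fin n → A) where
  carrier := {v | ∀ j ∉ I, v j = 0}
  zero_mem' _ _ := rfl
  add_mem' ha hb j hj := by simp [ha j hj, hb j hj]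
  neg_mem' ha j hj := by simp [ha j hj]

namespace IsStabilizerGroup

variable {d n : ℕ} [NeZero d] {G : Subgroup (Op d n)ˣ} (hG : IsStabilizerGroup G)

include hG in
theorem exists_eq_smul_weyl (g : G) :
    ∃ v : PhaseSpace d n, ∃ c : ℂ, c ≠ 0 ∧ ((g : (Op d n)ˣ) : Op d n) = c • weyl v := by
  obtain ⟨c, v, h⟩ := hG.weyl_multiple g g.2
  exact ⟨v, c, fun h0 => g.1.ne_zero (by rw [h, h0, zero_smul]), h⟩

/-- The label `v` of an element `c • w(v)` of a stabilizer group. -/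
def label (g : G) : PhaseSpace d n := (hG.exists_eq_smul_weyl g).choose

theorem label_spec (g : G) :
    ∃ c : ℂ, c ≠ 0 ∧ ((g : (Op d n)ˣ) : Op d n) = c • weyl (hG.label g) :=
  (hG.exists_eq_smul_weyl g).choose_spec

theorem label_mul (g h : G) : hG.label (g * h) = hG.label g + hG.label h := by
  obtain ⟨a, ha, ha'⟩ := hG.label_spec g
  obtain ⟨b, hb, hb'⟩ := hG.label_spec h
  obtain ⟨c, hc, hc'⟩ := hG.label_spec (g * h)
  obtain ⟨r, hr, hr'⟩ := weyl_mul (hG.label g) (hG.label h)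
  refine eq_of_smul_weyl_eq hc (b := a * b * r) ?_
  rw [← hc', Subgroup.coe_mul, Units.val_mul, ha', hb', smul_mul_smul_comm, hr', smul_smul]

theorem eq_one_of_label_eq_zero {g : G} (hg : hG.label g = 0) : g = 1 := by
  obtain ⟨c, -, hc⟩ := hG.label_spec g
  rw [hg, weyl_zero] at hc
  exact Subtype.ext (hG.scalar_trivial g g.2 c hc)

/-- The label as a homomorphism from the stabilizer group to the phase space. -/
def labelHom : Additive G →+ PhaseSpace d n :=
  AddMonoidHom.mk' (fun g => hG.label g.toMul) fun g h => hG.label_mul g.toMul h.toMul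

theorem labelHom_injective : Function.Injective hG.labelHom :=
  (injective_iff_map_eq_zero _).mpr fun _ hg => hG.eq_one_of_label_eq_zero hg

include hG in
/-- The elements of a stabilizer group are unitary, since they have finite order. -/
theorem conjTranspose_eq (g : G) :
    ((g : (Op d n)ˣ) : Op d n)ᴴ = ((g⁻¹ : G) : (Op d n)ˣ) := by
  have := hG.finite
  obtain ⟨c, hc, h⟩ := hG.label_spec g
  have h1 : ((g : (Op d n)ˣ) : Op d n)ᴴ = ((‖c‖ : ℂ) ^ 2) • (((g⁻¹ : G) : (Op d n)ˣ) : Op d n) := by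
    have h2 : ((g : (Op d n)ˣ) : Op d n)ᴴ * ((g : (Op d n)ˣ) : Op d n) =
        ((‖c‖ : ℂ) ^ 2) • (1 : Op d n) := by
      rw [h, Matrix.conjTranspose_smul, smul_mul_smul_comm, weyl_conjTranspose_mul,
        RCLike.star_def, RCLike.conj_mul]
      rfl
    rw [Subgroup.coe_inv, ← mul_one (((g : (Op d n)ˣ) : Op d n)ᴴ), ← Units.mul_inv (g : (Op d n)ˣ),
      ← mul_assoc, h2, smul_mul_assoc, one_mul]
  have hm := pow_orderOf_eq_one g
  have hm' : ((g : (Op d n)ˣ) : Op d n) ^ orderOf g = 1 := by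
    rw [← Units.val_pow_eq_pow_val, ← Subgroup.coe_pow, hm, Subgroup.coe_one, Units.val_one]
  have hi' : (((g⁻¹ : G) : (Op d n)ˣ) : Op d n) ^ orderOf g = 1 := by
    rw [← Units.val_pow_eq_pow_val, ← Subgroup.coe_pow, inv_pow, hm, inv_one, Subgroup.coe_one,
      Units.val_one]
  have h3 := congrArg (· ^ orderOf g) h1
  simp only [smul_pow, hi', ← Matrix.conjTranspose_pow, hm', Matrix.conjTranspose_one] at h3
  have h4 : ((‖c‖ : ℂ) ^ 2) ^ orderOf g = 1 := by
    simpa using (congrFun (congrFun h3 0) 0).symm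
  have h5 : (‖c‖ ^ 2) ^ orderOf g = 1 := by exact_mod_cast h4
  have h6 : ‖c‖ ^ 2 = 1 :=
    (pow_eq_one_iff_of_nonneg (by positivity) (orderOf_pos g).ne').mp h5
  rw [h1, ← Complex.ofReal_pow, h6, Complex.ofReal_one, one_smul]

include hG in
theorem isHermitian_state [Fintype G] :
    (((d : ℂ) ^ n)⁻¹ • ∑ g : G, ((g : (Op d n)ˣ) : Op d n)).IsHermitian := by
  rw [Matrix.IsHermitian, Matrix.conjTranspose_smul, Matrix.conjTranspose_sum]
  congr 1
  · simp
  · rw [Finset.sum_congr rfl fun g _ => hG.conjTranspose_eq g]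
    exact Equiv.sum_comp (Equiv.inv G) fun g : G => ((g : (Op d n)ˣ) : Op d n)

include hG in
theorem trace_state [Fintype G] :
    (((d : ℂ) ^ n)⁻¹ • ∑ g : G, ((g : (Op d n)ˣ) : Op d n)).trace = 1 := by
  rw [Matrix.trace_smul, Matrix.trace_sum, Finset.sum_eq_single 1]
  · simp [ZMod.card, NeZero.ne d]
  · intro g _ hg
    obtain ⟨c, -, h⟩ := hG.label_spec g
    rw [h, Matrix.trace_smul, trace_weyl fun h0 => hg (hG.eq_one_of_label_eq_zero h0), smul_zero]
  · simp

/-- The subgroup of the elements that act trivially outside `I`. -/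
def localized (I : Finset (Fin n)) : Subgroup G where
  carrier := {g | hG.label g ∈ supported _ I}
  one_mem' := by
    have : hG.label 1 = 0 := hG.labelHom.map_zero
    rw [Set.mem_ofPred_eq, this]
    exact zero_mem _
  mul_mem' ha hb := by
    rw [Set.mem_ofPred_eq, label_mul]
    exact add_mem ha hb
  inv_mem' {a} ha := by
    have : hG.label a⁻¹ = -hG.label a := hG.labelHom.map_neg (Additive.ofMul a)
    rw [Set.mem_ofPred_eq, this]
    exact neg_mem ha

theorem card_localized (I : Finset (Fin n)) :
    Nat.card (hG.localized I) =
      Nat.card ↥(hG.labelHom.range ⊓ supported (ZMod d × ZMod d) I) := by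
  refine Nat.card_congr (Equiv.ofBijective
    (fun g => ⟨hG.label g, ⟨Additive.ofMul g.1, rfl⟩, g.2⟩) ⟨fun g h hgh => ?_, ?_⟩)
  · exact Subtype.ext (hG.labelHom_injective (congrArg Subtype.val hgh))
  · rintro ⟨_, ⟨g, rfl⟩, hg⟩
    exact ⟨⟨g.toMul, hg⟩, rfl⟩

/-- On the elements that act trivially outside `I`, the normalized partial trace is
multiplicative: it removes the trivial tensor factors. -/
theorem reduced_mul {I : Finset (Fin n)} {g h : G} (hg : g ∈ hG.localized I)
    (hh : h ∈ hG.localized I) :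
    reduced ((g : (Op d n)ˣ) : Op d n) I * reduced ((h : (Op d n)ˣ) : Op d n) I =
      ((d : ℂ) ^ (n - I.card)) • reduced (((g * h : G) : (Op d n)ˣ) : Op d n) I := by
  obtain ⟨a, -, ha⟩ := hG.label_spec g
  obtain ⟨b, -, hb⟩ := hG.label_spec h
  have key : reduced (weyl (hG.label g)) I * reduced (weyl (hG.label h)) I =
      ((d : ℂ) ^ (n - I.card)) • reduced (weyl (hG.label g) * weyl (hG.label h)) I := by
    rw [reduced_weyl_of_support hg, reduced_weyl_of_support hh, weyl, weyl, tensor_mul,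
      reduced_tensor, Finset.prod_congr rfl fun (j : {j // j ∉ I}) _ => by
        rw [hg j j.2, hh j j.2, weylOne_zero, mul_one, Matrix.trace_one, ZMod.card],
      ← tensor_mul, smul_mul_smul_comm, smul_smul]
    congr 1
    simp [Fintype.card_subtype_compl]
  rw [Subgroup.coe_mul, Units.val_mul, ha, hb, smul_mul_smul_comm a]
  simp only [← reducedLinear_apply, map_smul] at key ⊢
  rw [smul_mul_smul_comm, key, smul_comm]

/-- The entropy of a reduced stabilizer state counts the elements of the stabilizer group that act
trivially outside `I`: the reduced state is a multiple of a projection. -/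
theorem entropyVector_eq (I : Finset (Fin n)) :
    entropyVector (((d : ℂ) ^ n)⁻¹ • ∑ᶠ g : G, ((g : (Op d n)ˣ) : Op d n)) I =
      I.card * Real.logb 2 d -
        Real.logb 2 (Nat.card ↥(hG.labelHom.range ⊓ supported (ZMod d × ZMod d) I)) := by
  classical
  have := hG.finite
  have := Fintype.ofFinite G
  rw [finsum_eq_sum_of_fintype, entropyVector, ← hG.card_localized]
  set K := hG.localized I
  have hd : (d : ℂ) ≠ 0 := Nat.cast_ne_zero.mpr (NeZero.ne d)
  have hI : I.card ≤ n := by simpa using I.card_le_univ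
  have hpow : (d : ℂ) ^ n = (d : ℂ) ^ (n - I.card) * (d : ℂ) ^ I.card := by
    rw [← pow_add, Nat.sub_add_cancel hI]
  have hsum : reduced (((d : ℂ) ^ n)⁻¹ • ∑ g : G, ((g : (Op d n)ˣ) : Op d n)) I =
      ((d : ℂ) ^ n)⁻¹ • ∑ g : K, reduced ((g : (Op d n)ˣ) : Op d n) I := by
    rw [← reducedLinear_apply, map_smul, map_sum]
    congr 1
    have h0 : ∑ g : {g // g ∉ K}, reducedLinear I ((g : (Op d n)ˣ) : Op d n) = 0 := by
      refine Finset.sum_eq_zero fun g _ => ?_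
      obtain ⟨c, -, hc⟩ := hG.label_spec g
      rw [hc, map_smul, reducedLinear_apply, reduced_weyl_of_not_support g.2, smul_zero]
    rw [← Fintype.sum_subtype_add_sum_subtype (· ∈ K), h0, add_zero]
    exact Fintype.sum_equiv (Equiv.refl _) _ _ fun g => rfl
  have hcard : (0 : ℝ) < Nat.card K := Nat.cast_pos.mpr Nat.card_pos
  have hd' : (0 : ℝ) < (d : ℝ) ^ I.card := pow_pos (Nat.cast_pos.mpr (NeZero.pos d)) _
  have hmul : reduced (((d : ℂ) ^ n)⁻¹ • ∑ g : G, ((g : (Op d n)ˣ) : Op d n)) I *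
      reduced (((d : ℂ) ^ n)⁻¹ • ∑ g : G, ((g : (Op d n)ˣ) : Op d n)) I =
      ((Nat.card K : ℝ) / (d : ℝ) ^ I.card) •
        reduced (((d : ℂ) ^ n)⁻¹ • ∑ g : G, ((g : (Op d n)ˣ) : Op d n)) I := by
    have h1 : (∑ g : K, reduced ((g : (Op d n)ˣ) : Op d n) I) *
        (∑ g : K, reduced ((g : (Op d n)ˣ) : Op d n) I) =
        ((Nat.card K : ℂ) * (d : ℂ) ^ (n - I.card)) •
          ∑ g : K, reduced ((g : (Op d n)ˣ) : Op d n) I := by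
      rw [Finset.sum_mul_sum, mul_smul]
      have h2 : ∀ g : K, ∑ h : K, reduced ((g : (Op d n)ˣ) : Op d n) I *
          reduced ((h : (Op d n)ˣ) : Op d n) I =
          ((d : ℂ) ^ (n - I.card)) • ∑ h : K, reduced ((h : (Op d n)ˣ) : Op d n) I := by
        intro g
        rw [← Equiv.sum_comp (Equiv.mulLeft g) fun h : K => reduced ((h : (Op d n)ˣ) : Op d n) I,
          Finset.smul_sum]
        exact Finset.sum_congr rfl fun h _ => hG.reduced_mul g.2 h.2
      rw [Finset.sum_congr rfl fun g _ => h2 g, Finset.sum_const, Finset.card_univ,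
        ← Nat.card_eq_fintype_card, Nat.cast_smul_eq_nsmul]
    rw [hsum, smul_mul_smul_comm, h1, ← Complex.coe_smul, smul_smul, smul_smul]
    congr 1
    push_cast
    rw [hpow]
    field_simp
  rw [vonNeumannEntropy_of_mul_self (isHermitian_reduced hG.isHermitian_state I) hmul
    ((trace_reduced _ _).trans hG.trace_state), Real.logb_div hcard.ne' hd'.ne',
    Real.logb_pow]
  ring

end IsStabilizerGroup

/-! ### Linear rank inequalities -/

theorem IsBalanced.sum_mul_card {n : ℕ} {f : Finset (Fin n) → ℝ} (hf : IsBalanced f) :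
    ∑ I, f I * (I.card : ℝ) = 0 := by
  have h : ∀ I : Finset (Fin n), f I * (I.card : ℝ) = ∑ i : Fin n, if i ∈ I then f I else 0 := by
    intro I
    rw [← Finset.sum_filter, Finset.sum_const, nsmul_eq_mul, Finset.filter_univ_mem, mul_comm]
  rw [Finset.sum_congr rfl fun I _ => h I, Finset.sum_comm]
  refine Finset.sum_eq_zero fun i _ => ?_
  rw [← Finset.sum_filter]
  exact hf i

section Field

variable {F B : Type} [Field F] [AddCommGroup B] [Module F B] {n : ℕ}

/-- The subspace of vectors that vanish outside `I`. -/
def supportedSubmodule (F B : Type) [Field F] [AddCommGroup B] [Module F B] (I : Finset (Fin n)) :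
    Submodule F (Fin n → B) :=
  ⨅ i ∈ (I : Set (Fin n))ᶜ, LinearMap.ker (LinearMap.proj (R := F) (φ := fun _ => B) i)

theorem mem_supportedSubmodule {I : Finset (Fin n)} {v : Fin n → B} :
    v ∈ supportedSubmodule F B I ↔ ∀ j ∉ I, v j = 0 := by
  simp [supportedSubmodule]

theorem finrank_supportedSubmodule [FiniteDimensional F B] (I : Finset (Fin n)) :
    Module.finrank F (supportedSubmodule F B I) = I.card * Module.finrank F B := by
  classical
  rw [supportedSubmodule, (LinearMap.iInfKerProjEquiv F (fun _ : Fin n => B)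
    (disjoint_compl_right (a := (I : Set (Fin n)))) (by simp)).finrank_eq,
    Module.finrank_pi_fintype]
  simp

/-- The images `U i` of the coordinate subspaces in the quotient `(Fin n → B) ⧸ N` span, for
`i ∈ I`, a space of dimension `|I| dim B - dim (N ⊓ supported I)`; the first term does not
contribute to a balanced functional. -/
theorem IsLinearRankInequality.sum_mul_finrank_nonpos [Finite F] [FiniteDimensional F B]
    {f : Finset (Fin n) → ℝ} (hf : IsLinearRankInequality f) (hb : IsBalanced f)
    (N : Submodule F (Fin n → B)) :
    ∑ I, f I * (Module.finrank F ↥(N ⊓ supportedSubmodule F B I) : ℝ) ≤ 0 := by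
  have key : ∀ I : Finset (Fin n),
      Module.finrank F ↥(⨆ i ∈ I, (LinearMap.range (LinearMap.single F (fun _ => B) i)).map N.mkQ) +
        Module.finrank F ↥(N ⊓ supportedSubmodule F B I) = I.card * Module.finrank F B := by
    intro I
    have hsup : ⨆ i ∈ I, (LinearMap.range (LinearMap.single F (fun _ => B) i)).map N.mkQ =
        (supportedSubmodule F B I).map N.mkQ := by
      rw [supportedSubmodule, ← LinearMap.iSup_range_single_eq_iInf_ker_proj F (fun _ : Fin n => B)
        isCompl_compl I.finite_toSet]
      simp only [Submodule.map_iSup, Finset.mem_coe]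
    rw [hsup, ← finrank_supportedSubmodule (F := F) (B := B) I,
      ← LinearMap.finrank_range_add_finrank_ker (N.mkQ.domRestrict (supportedSubmodule F B I)),
      LinearMap.range_domRestrict, LinearMap.ker_domRestrict, Submodule.ker_mkQ,
      ← Submodule.finrank_map_subtype_eq, Submodule.map_comap_subtype, inf_comm]
  have h1 := hf F ((Fin n → B) ⧸ N)
    fun i => (LinearMap.range (LinearMap.single F (fun _ => B) i)).map N.mkQ
  have h2 : ∑ I, f I * ((I.card * Module.finrank F B : ℕ) : ℝ) = 0 := by
    have := congrArg (· * (Module.finrank F B : ℝ)) hb.sum_mul_card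
    simpa [Finset.sum_mul, mul_assoc] using this
  simp only [← key, Nat.cast_add, mul_add, Finset.sum_add_distrib] at h2
  linarith

end Field

/-! ### Primary decomposition -/

/-- A finite abelian group killed by a product of pairwise coprime numbers is the product of its
torsion subgroups. -/
theorem card_eq_prod_card_torsionBy {ι : Type*} [Fintype ι] {p : ι → ℕ}
    (hp : Pairwise (Function.onFun Nat.Coprime p)) {A : Type*} [AddCommGroup A]
    (hA : ∀ a : A, (∏ i, p i) • a = 0) :
    Nat.card A = ∏ i, Nat.card (AddSubgroup.torsionBy A (p i : ℤ)) := by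
  classical
  have h := Submodule.torsionBy_isInternal (R := ℤ) (M := A) (S := Finset.univ)
    (q := fun i => (p i : ℤ)) (fun i _ j _ hij => Nat.isCoprime_iff_coprime.mpr (hp hij))
    (fun a => by rw [← Nat.cast_prod, natCast_zsmul]; exact hA a)
  rw [← Nat.card_congr (Equiv.ofBijective _ h), Nat.card_congr (DirectSum.addEquivProd _).toEquiv,
    Nat.card_pi]
  exact Finset.prod_coe_sort Finset.univ fun i => Nat.card (Submodule.torsionBy ℤ A (p i : ℤ))

/-- The group-theoretic form of a balanced linear rank inequality, for groups of square-free
exponent: each torsion part is a vector space over a prime field. -/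
theorem IsLinearRankInequality.sum_mul_logb_card_nonpos {ι : Type*} [Fintype ι] {p : ι → ℕ}
    [∀ i, Fact (p i).Prime] (hp : Pairwise (Function.onFun Nat.Coprime p)) {n : ℕ}
    {f : Finset (Fin n) → ℝ} (hf : IsLinearRankInequality f) (hb : IsBalanced f)
    {B : Type} [AddCommGroup B] [Finite B] (hB : ∀ b : B, (∏ i, p i) • b = 0)
    (M : AddSubgroup (Fin n → B)) :
    ∑ I, f I * Real.logb 2 (Nat.card ↥(M ⊓ supported B I)) ≤ 0 := by
  let (i : ι) : Module (ZMod (p i)) (AddSubgroup.torsionBy B (p i : ℤ)) :=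
    AddSubgroup.torsionBy.zmodModule
  let N : ∀ i, Submodule (ZMod (p i)) (Fin n → AddSubgroup.torsionBy B (p i : ℤ)) := fun i =>
    AddSubgroup.toZModSubmodule (p i)
      (M.comap ((AddSubgroup.torsionBy B (p i : ℤ)).subtype.compLeft (Fin n)))
  have hcard : ∀ I : Finset (Fin n), Nat.card ↥(M ⊓ supported B I) =
      ∏ i, p i ^ Module.finrank (ZMod (p i)) ↥(N i ⊓
        supportedSubmodule (ZMod (p i)) (AddSubgroup.torsionBy B (p i : ℤ)) I) := by
    intro I
    rw [card_eq_prod_card_torsionBy hp fun a => Subtype.ext (funext fun j => hB _)]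
    refine Finset.prod_congr rfl fun i _ => ?_
    have h1 := Module.natCard_eq_pow_finrank (K := ZMod (p i))
      (V := ↥(N i ⊓ supportedSubmodule (ZMod (p i)) (AddSubgroup.torsionBy B (p i : ℤ)) I))
    rw [Nat.card_zmod] at h1
    rw [← h1]
    have htor : ∀ v : ↥(AddSubgroup.torsionBy ↥(M ⊓ supported B I) (p i : ℤ)), ∀ j,
        (p i : ℤ) • (v.1.1 j) = 0 := fun v j =>
      congrFun (congrArg Subtype.val ((Submodule.mem_torsionBy_iff _ _).mp v.2)) j
    refine Nat.card_congr
      { toFun := fun v => ⟨fun j => ⟨v.1.1 j, htor v j⟩, v.1.2.1,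
          mem_supportedSubmodule.mpr fun j hj => Subtype.ext (v.1.2.2 j hj)⟩
        invFun := fun w => ⟨⟨fun j => (w.1 j : B), w.2.1, fun j hj =>
          congrArg Subtype.val (mem_supportedSubmodule.mp w.2.2 j hj)⟩,
            Subtype.ext (funext fun j => (w.1 j).2)⟩
        left_inv := fun v => rfl
        right_inv := fun w => rfl }
  have hlog : ∀ I : Finset (Fin n), Real.logb 2 (Nat.card ↥(M ⊓ supported B I)) =
      ∑ i, (Module.finrank (ZMod (p i)) ↥(N i ⊓
        supportedSubmodule (ZMod (p i)) (AddSubgroup.torsionBy B (p i : ℤ)) I) : ℝ) *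
        Real.logb 2 (p i) := by
    intro I
    rw [hcard, Nat.cast_prod, Real.logb_prod]
    · simp only [Nat.cast_pow, Real.logb_pow]
    · exact fun i _ => Nat.cast_ne_zero.mpr (pow_ne_zero _ (Fact.out : (p i).Prime).ne_zero)
  simp only [hlog, Finset.mul_sum]
  rw [Finset.sum_comm]
  refine Finset.sum_nonpos fun i _ => ?_
  simp only [← mul_assoc, ← Finset.sum_mul]
  exact mul_nonpos_of_nonpos_of_nonneg (hf.sum_mul_finrank_nonpos hb (N i))
    (Real.logb_nonneg one_lt_two (Nat.one_le_cast.mpr (Fact.out : (p i).Prime).one_le))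

end StabilizerEntropy

end

theorem mainTheorem6 (k : ℕ) (p : Fin k → ℕ) [∀ i, Fact (p i).Prime]
    (hp : Function.Injective p) (d : ℕ) [NeZero d] (hd : d = ∏ i, p i) (n : ℕ)
    (ρ : StabilizerEntropy.Op d n) (hρ : StabilizerEntropy.IsStabilizerState ρ) :
    -- A unitary `U : ℂ^d → ⊗ᵢ ℂ^{pᵢ}` is a tensor product structure on the local space `ℂ^d`;
    -- the right-hand side below regroups `⊗ᵢ (ℂ^{pᵢ})^{⊗n}` as `(⊗ᵢ ℂ^{pᵢ})^{⊗n}`.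
    (∃ (U : Matrix (∀ i, ZMod (p i)) (ZMod d) ℂ) (σ : ∀ i, StabilizerEntropy.Op (p i) n),
      U * U.conjTranspose = 1 ∧ U.conjTranspose * U = 1 ∧
      (∀ i, StabilizerEntropy.IsStabilizerState (σ i)) ∧
      StabilizerEntropy.tensor (fun _ : Fin n => U) * ρ *
          (StabilizerEntropy.tensor (fun _ : Fin n => U)).conjTranspose =
        (StabilizerEntropy.tensor σ).submatrix (fun x i j => x j i) (fun x i j => x j i)) ∧
    (∀ f : Finset (Fin n) → ℝ,
      StabilizerEntropy.IsBalanced f → StabilizerEntropy.IsLinearRankInequality f →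
      0 ≤ ∑ I : Finset (Fin n), f I * StabilizerEntropy.entropyVector ρ I) := by
  have hcop : Pairwise (Function.onFun Nat.Coprime p) := fun i j hij =>
    (Nat.coprime_primes Fact.out Fact.out).mpr (hp.ne hij)
  constructor
  · let e : ZMod d ≃+* ∀ i, ZMod (p i) := (ZMod.ringEquivCongr hd).trans (ZMod.prodEquivPi p hcop)
    obtain ⟨σ, hσ, rfl⟩ := hρ.exists_eq_localHom hcop hd e
    obtain ⟨U, h1, h2, h3⟩ := StabilizerEntropy.exists_unitary_conj_localHom (n := n) e
    exact ⟨U, σ, h1, h2, hσ, h3 σ⟩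
  · intro f hb hf
    obtain ⟨G, hG, rfl⟩ := hρ
    have h1 := hf.sum_mul_logb_card_nonpos hcop hb (B := ZMod d × ZMod d)
      (fun b => by rw [← hd, ← Nat.cast_smul_eq_nsmul (ZMod d), ZMod.natCast_self, zero_smul])
      hG.labelHom.range
    have h2 := congrArg (· * Real.logb 2 d) hb.sum_mul_card
    simp only [Finset.sum_mul, zero_mul, mul_assoc] at h2
    simp only [hG.entropyVector_eq, mul_sub, Finset.sum_sub_distrib]
    linarith
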